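/- Notation. Let $L^1(\mathbb{R})$ be the real Lebesgue space and $L^\infty(\mathbb{R})$ the complex Banach space of essentially bounded functions on $\mathbb{R}$ modulo a.e. equality. Let $P(\mathbb{R})$ be the set of $f\in L^1(\mathbb{R})$ with $f\ge 0$ a.e. and $\int_{\mathbb{R}} f(t)\,dt=1$. A *topologically invariant mean* on $L^\infty(\mathbb{R})$ is a continuous linear functional $\Phi\in L^\infty(\mathbb{R})^*$ such that $\Phi(\phi)\ge 0$ whenever $\phi\ge 0$ a.e., $\Phi(1)=1$, and $\Phi(f*\phi)=\Phi(\phi)$ for all $f\in P(\mathbb{R})$ and $\phi\in L^\infty(\mathbb{R})$, where $(f*\phi)(x)=\int_{\mathbb{R}}\phi(x-t)f(t)\,dt$. Let $\mathbb{C}^+=\{z\in\mathbb{C}:\operatorname{Re} z>0\}$ and let $H^\infty(\mathbb{C}^+)$ be the algebra of bounded analytic functions on $\mathbb{C}^+$ with the supremum norm. Its maximal ideal space $\mathfrak{M}$ is the set of nonzero multiplicative continuous linear functionals $\chi:H^\infty(\mathbb{C}^+)\to\mathbb{C}$, with the weak* topology; for $z\in\mathbb{C}^+$ let $\hat z\in\mathfrak{M}$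 be the evaluation $\hat z(\phi)=\phi(z)$. A function $\psi\in L^\infty(\mathbb{R})$ is the *boundary function* of $\phi\in H^\infty(\mathbb{C}^+)$ if for a.e. $y\in\mathbb{R}$ the nontangential limit of $\phi$ at $iy$ exists and equals $\psi(y)$, that is, for every $M>0$, $\phi(z)\to\psi(y)$ as $z\to iy$ within $\{z\in\mathbb{C}^+:|\operatorname{Im} z-y|<M\operatorname{Re} z\}$. **Theorem 4.3.** Let $\chi\in\mathfrak{M}$ and suppose that there is a net $(z_\alpha)$ in $\mathbb{C}^+$ with $\operatorname{Re} z_\alpha\to\infty$ and $\hat z_\alpha\to\chi$ in the weak* topology. Then there exists a topologically invariant mean $\Phi$ on $L^\infty(\mathbb{R})$ whose restriction to $H^\infty(\mathbb{C}^+)$, embedded in $L^\infty(\mathbb{R})$ through boundary functions, is $\chi$: every $\phi\in H^\infty(\mathbb{C}^+)$ has a boundary function $\psi\in L^\infty(\mathbb{R})$, and $\Phi(\psi)=\chi(\phi)$. -/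

import Mathlib

open MeasureTheory Filter Topology
open scoped ENNReal ComplexOrder BoundedContinuousFunction Convolution

noncomputable section

namespace HalfPlane

/-! ### Means on `L^∞(ℝ)` -/

/-- The Banach space `L^∞(ℝ)` of complex essentially bounded functions modulo a.e. equality. -/
abbrev LInfty : Type := Lp ℂ ∞ (volume : Measure ℝ)

/-- The constant function `1` in `L^∞(ℝ)`. -/
def oneLInfty : LInfty := (memLp_top_const (1 : ℂ)).toLp (fun _ : ℝ => (1 : ℂ))

/-- The convolution `x ↦ ∫ f(t) φ(x - t) dt` of `f ∈ L^1(ℝ)` and `φ ∈ L^∞(ℝ)` is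
essentially bounded. -/
theorem memLp_convolution (f : Lp ℝ 1 (volume : Measure ℝ)) (φ : LInfty) :
    MemLp (f ⋆[ContinuousLinearMap.lsmul ℝ ℝ, volume] φ : ℝ → ℂ) ∞ volume := by
  have hf : Integrable (f : ℝ → ℝ) volume := L1.integrable_coeFn f
  have hm : AEStronglyMeasurable
      (f ⋆[ContinuousLinearMap.lsmul ℝ ℝ, volume] φ : ℝ → ℂ) volume :=
    (AEStronglyMeasurable.convolution_integrand (ContinuousLinearMap.lsmul ℝ ℝ)
      hf.aestronglyMeasurable (Lp.aestronglyMeasurable φ)).integral_prod_right'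
  have hb : ∀ᵐ y ∂(volume : Measure ℝ), ‖φ y‖ ≤ ‖φ‖ := by
    filter_upwards [ae_le_eLpNormEssSup (f := φ) (μ := volume)] with y hy
    rw [← eLpNorm_exponent_top, ← Lp.enorm_def] at hy
    exact enorm_le_iff_norm_le.mp hy
  refine memLp_top_of_bound hm (∫ t, ‖f t‖ * ‖φ‖) (Eventually.of_forall fun x => ?_)
  refine norm_integral_le_of_norm_le (hf.norm.mul_const _) ?_
  have hx : ∀ᵐ t ∂(volume : Measure ℝ), ‖φ (x - t)‖ ≤ ‖φ‖ :=
    (quasiMeasurePreserving_sub_left volume x).ae hb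
  filter_upwards [hx] with t ht
  simp only [ContinuousLinearMap.lsmul_apply, norm_smul]
  gcongr

/-- The convolution `f * φ` of `f ∈ L^1(ℝ)` and `φ ∈ L^∞(ℝ)`, as an element of `L^∞(ℝ)`. -/
def conv (f : Lp ℝ 1 (volume : Measure ℝ)) (φ : LInfty) : LInfty :=
  (memLp_convolution f φ).toLp _

/-- The set `P(ℝ)` of all `f ∈ L^1(ℝ)` with `f ≥ 0` and `∫ f = 1`. -/
def densities : Set (Lp ℝ 1 (volume : Measure ℝ)) :=
  {f | (∀ᵐ t, 0 ≤ f t) ∧ ∫ t, f t = 1}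

/-- A mean on `L^∞(ℝ)`: a continuous linear functional that is positive and normalized. -/
structure IsMean (Φ : StrongDual ℂ LInfty) : Prop where
  /-- `0 ≤ w` for a complex number `w` means that `w` is real and nonnegative. -/
  nonneg : ∀ φ : LInfty, (∀ᵐ t, 0 ≤ φ t) → 0 ≤ Φ φ
  map_one : Φ oneLInfty = 1

/-- A topologically invariant mean: `Φ (f * φ) = Φ φ` for all `f ∈ P(ℝ)`, `φ ∈ L^∞(ℝ)`. -/
structure IsTopologicallyInvariantMean (Φ : StrongDual ℂ LInfty) : Prop extends IsMean Φ where
  map_conv : ∀ f ∈ densities, ∀ φ : LInfty, Φ (conv f φ) = Φ φ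

/-! ### Bounded analytic functions on the right half plane -/

/-- The open right half plane `ℂ⁺`. -/
def rightHalfPlane : Set ℂ := {z | 0 < z.re}

/-- The algebra `H^∞(ℂ⁺)` of bounded analytic functions on the right half plane, with pointwise
operations and the supremum norm. -/
def HInfty : Subalgebra ℂ (rightHalfPlane →ᵇ ℂ) where
  carrier := {φ | ∃ g : ℂ → ℂ, DifferentiableOn ℂ g rightHalfPlane ∧
    ∀ z : rightHalfPlane, φ z = g z}
  mul_mem' := by
    rintro a b ⟨g, hg, ha⟩ ⟨h, hh, hb⟩
    exact ⟨fun z => g z * h z, hg.mul hh, fun z => by simp [ha, hb]⟩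
  add_mem' := by
    rintro a b ⟨g, hg, ha⟩ ⟨h, hh, hb⟩
    exact ⟨fun z => g z + h z, hg.add hh, fun z => by simp [ha, hb]⟩
  algebraMap_mem' := fun c =>
    ⟨fun _ => c, differentiableOn_const c, fun z => by simp⟩

/-- The maximal ideal space `𝔐` of `H^∞(ℂ⁺)`: the nonzero multiplicative continuous linear
functionals, with the weak* topology. -/
abbrev MaximalIdealSpace : Type := WeakDual.characterSpace ℂ HInfty

/-- Evaluation at a point of the right half plane, as a point of the maximal ideal space. -/
def pointEval (z : rightHalfPlane) : MaximalIdealSpace :=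
  ⟨StrongDual.toWeakDual
      ((BoundedContinuousFunction.evalCLM ℂ z).comp
        (Subalgebra.toSubmodule HInfty).subtypeL), by
    refine ⟨fun h => ?_, fun φ ψ => rfl⟩
    have h1 : (1 : ℂ) = 0 := DFunLike.congr_fun h (1 : HInfty)
    exact one_ne_zero h1⟩

theorem pointEval_apply (z : rightHalfPlane) (φ : HInfty) :
    pointEval z φ = (φ : rightHalfPlane →ᵇ ℂ) z := rfl

/-- The nontangential approach region at the boundary point `iy` with aperture `M`. -/
def approachRegion (M y : ℝ) : Set ℂ := {z | 0 < z.re ∧ |z.im - y| < M * z.re}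

/-- `ψ ∈ L^∞(ℝ)` is the boundary function `y ↦ φ(iy)` of `φ ∈ H^∞(ℂ⁺)`: for almost every `y`, the
function `φ` has the nontangential limit `ψ y` at `iy`. -/
def IsBoundaryFunction (φ : HInfty) (ψ : LInfty) : Prop :=
  ∀ᵐ y : ℝ, ∀ M : ℝ, Tendsto (fun z : rightHalfPlane => (φ : rightHalfPlane →ᵇ ℂ) z)
    (comap ((↑) : rightHalfPlane → ℂ) (𝓝[approachRegion M y] (y * Complex.I))) (𝓝 (ψ y))

end HalfPlane

end

/-!
The Poisson kernel of the half plane at `z_α` is a probability density on the boundary line, and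
translating it by `s` changes it by at most `min 2 (|s| / Re z_α)` in `L¹`. As `Re z_α → ∞`, every
weak* limit point of the functionals `ψ ↦ ∫ P_{z_α} ψ` is therefore a topologically invariant mean.
On the boundary function of `φ` these functionals take the value `φ(z_α)`, which tends to `χ(φ)`.

Boundary functions exist by a version of Fatou's theorem for bounded `φ`: a primitive of `φ` is
Lipschitz, hence differentiable along the boundary line at almost every point. Its difference
quotients at such a point are bounded and analytic, so they are Poisson integrals of their boundary
values, which upgrades the derivative along the line to a complex derivative within the half plane.
A Cauchy estimate on disks of radius `Re z / 2` then gives the nontangential limit of `φ`.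
-/

namespace HalfPlane

open ProbabilityTheory

/-! ### Harmonic measure on the boundary of the half plane -/

/-- The standard Cauchy distribution, with density `π⁻¹ (1 + u²)⁻¹`. -/
noncomputable abbrev stdCauchy : Measure ℝ := cauchyMeasure 0 1

section StdCauchy

variable {E : Type*} [NormedAddCommGroup E] [NormedSpace ℝ E]

theorem stdCauchy_absolutelyContinuous : stdCauchy ≪ volume := by
  rw [stdCauchy, cauchyMeasure_of_scale_ne_zero 0 one_ne_zero]
  exact withDensity_absolutelyContinuous _ _

theorem integral_stdCauchy (f : ℝ → E) :
    ∫ u, f u ∂stdCauchy = ∫ u, cauchyPDFReal 0 1 u • f u := by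
  rw [stdCauchy, cauchyMeasure_of_scale_ne_zero 0 one_ne_zero,
    integral_withDensity_eq_integral_toReal_smul (measurable_cauchyPDF 0 1) (by simp [cauchyPDF])]
  simp only [cauchyPDF, ENNReal.toReal_ofReal (cauchyPDF_pos 0 one_ne_zero _).le]

theorem integral_stdCauchy_comp_arctan (f : ℝ → E) :
    ∫ u, f (Real.arctan u) ∂stdCauchy =
      Real.pi⁻¹ • ∫ θ in (-(Real.pi / 2))..(Real.pi / 2), f θ := by
  have hsubst := integral_image_eq_integral_abs_deriv_smul MeasurableSet.univ
    (fun u _ => (Real.hasDerivAt_arctan' u).hasDerivWithinAt) Real.arctan_injective.injOn f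
  rw [Set.image_univ, Real.range_arctan, setIntegral_univ, ← integral_Ioc_eq_integral_Ioo,
    ← intervalIntegral.integral_of_le (by linarith [Real.pi_pos])] at hsubst
  rw [hsubst, integral_stdCauchy, ← integral_smul]
  refine integral_congr_ae (Eventually.of_forall fun u => ?_)
  have : (0 : ℝ) ≤ (1 + u ^ 2)⁻¹ := by positivity
  simp [cauchyPDFReal_def', smul_smul, abs_of_nonneg this]

theorem abs_cauchyPDFReal_add_sub_le (u h : ℝ) :
    |cauchyPDFReal 0 1 (u + h) - cauchyPDFReal 0 1 u| ≤
      |h| / 2 * (cauchyPDFReal 0 1 (u + h) + cauchyPDFReal 0 1 u) := by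
  have hp (v : ℝ) : cauchyPDFReal 0 1 v = Real.pi⁻¹ / (1 + v ^ 2) := by
    simp [cauchyPDFReal_def', div_eq_mul_inv]
  have hnum : |2 * u + h| ≤ ((1 + (u + h) ^ 2) + (1 + u ^ 2)) / 2 := by
    rw [abs_le]
    constructor <;>
      nlinarith [sq_nonneg (u + h - 1), sq_nonneg (u + h + 1), sq_nonneg (u - 1),
        sq_nonneg (u + 1)]
  have hden : 0 < (1 + (u + h) ^ 2) * (1 + u ^ 2) := by positivity
  calc |cauchyPDFReal 0 1 (u + h) - cauchyPDFReal 0 1 u|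
      = |Real.pi⁻¹ * -h * (2 * u + h) / ((1 + (u + h) ^ 2) * (1 + u ^ 2))| := by
        rw [hp, hp]
        congr 1
        field_simp
        ring
    _ = Real.pi⁻¹ * |h| * |2 * u + h| / ((1 + (u + h) ^ 2) * (1 + u ^ 2)) := by
        rw [abs_div, abs_mul, abs_mul, abs_neg, abs_of_pos hden,
          abs_of_pos (inv_pos.mpr Real.pi_pos)]
    _ ≤ Real.pi⁻¹ * |h| * (((1 + (u + h) ^ 2) + (1 + u ^ 2)) / 2) /
          ((1 + (u + h) ^ 2) * (1 + u ^ 2)) := by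
        gcongr
    _ = |h| / 2 * (cauchyPDFReal 0 1 (u + h) + cauchyPDFReal 0 1 u) := by
        rw [hp, hp]
        field_simp
        ring

theorem norm_integral_stdCauchy_comp_sub_sub_le {f : ℝ → E} (hf : AEStronglyMeasurable f volume)
    {c : ℝ} (hc : ∀ᵐ u, ‖f u‖ ≤ c) (h : ℝ) :
    ‖∫ u, f (u - h) ∂stdCauchy - ∫ u, f u ∂stdCauchy‖ ≤ |h| * c := by
  set p := cauchyPDFReal 0 1
  have hp : Integrable p := integrable_cauchyPDFReal 0
  have hph : Integrable fun u => p (u + h) := hp.comp_add_right h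
  have hi {q : ℝ → ℝ} (hq : Integrable q) : Integrable fun u => q u • f u := hq.smul_bdd c hf hc
  have hshift : ∫ u, f (u - h) ∂stdCauchy = ∫ u, p (u + h) • f u := by
    rw [integral_stdCauchy, ← integral_add_right_eq_self _ h]
    simp only [add_sub_cancel_right, p]
  rw [hshift, integral_stdCauchy, ← integral_sub (hi hph) (hi hp)]
  calc ‖∫ u, p (u + h) • f u - p u • f u‖
      ≤ ∫ u, |h| / 2 * (p (u + h) + p u) * c := by
        refine norm_integral_le_of_norm_le (((hph.add hp).const_mul _).mul_const _) ?_
        filter_upwards [hc] with u hu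
        rw [← sub_smul, norm_smul, Real.norm_eq_abs]
        exact mul_le_mul (abs_cauchyPDFReal_add_sub_le u h) hu (norm_nonneg _)
          ((abs_nonneg _).trans (abs_cauchyPDFReal_add_sub_le u h))
    _ = |h| * c := by
        rw [integral_mul_const, integral_const_mul, integral_add hph hp,
          integral_add_right_eq_self p h, integral_cauchyPDFReal_eq_one 0 one_ne_zero]
        ring

end StdCauchy

/-- The harmonic measure of the right half plane at `z`, on the boundary line parametrized by
`t ↦ it`: the Cauchy distribution with location `Im z` and scale `Re z`. It is written as an image
of the standard Cauchy distribution so that limits in `z` can be taken under a fixed measure. -/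
noncomputable def harmonicMeasure (z : ℂ) : Measure ℝ :=
  stdCauchy.map fun u => z.im + z.re * u

section HarmonicMeasure

variable {E : Type*} [NormedAddCommGroup E] [NormedSpace ℝ E] {z : ℂ}

instance (z : ℂ) : IsProbabilityMeasure (harmonicMeasure z) :=
  Measure.isProbabilityMeasure_map (by fun_prop)

theorem quasiMeasurePreserving_affine (y : ℝ) {x : ℝ} (hx : x ≠ 0) :
    Measure.QuasiMeasurePreserving (fun u => y + x * u) := by
  have hmul : Measure.QuasiMeasurePreserving fun u : ℝ => x * u := by
    refine ⟨by fun_prop, ?_⟩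
    rw [Real.map_volume_mul_left hx]
    exact Measure.smul_absolutelyContinuous
  exact (measurePreserving_add_left volume y).quasiMeasurePreserving.comp hmul

theorem harmonicMeasure_absolutelyContinuous (hz : 0 < z.re) : harmonicMeasure z ≪ volume :=
  ((quasiMeasurePreserving_affine z.im hz.ne').mono_left
    stdCauchy_absolutelyContinuous).absolutelyContinuous

theorem integral_harmonicMeasure (hz : 0 < z.re) (f : ℝ → E) :
    ∫ t, f t ∂harmonicMeasure z = ∫ u, f (z.im + z.re * u) ∂stdCauchy :=
  ((measurableEmbedding_addLeft z.im).comp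
    (measurableEmbedding_mulLeft₀ hz.ne')).integral_map f

theorem continuous_integral_harmonicMeasure {f : ℝ → E} (hf : Continuous f) {c : ℝ}
    (hc : ∀ t, ‖f t‖ ≤ c) : Continuous fun z => ∫ t, f t ∂harmonicMeasure z := by
  have hmap (z : ℂ) : ∫ t, f t ∂harmonicMeasure z = ∫ u, f (z.im + z.re * u) ∂stdCauchy :=
    integral_map (by fun_prop) hf.stronglyMeasurable.aestronglyMeasurable
  simp only [hmap]
  refine continuous_of_dominated (bound := fun _ => c) (fun z => ?_)
    (fun z => Eventually.of_forall fun u => hc _) (integrable_const _)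
    (Eventually.of_forall fun u => by fun_prop)
  exact (Continuous.stronglyMeasurable (by fun_prop)).aestronglyMeasurable

theorem harmonicMeasure_of_re_eq_zero (hz : z.re = 0) :
    harmonicMeasure z = Measure.dirac z.im := by
  simp [harmonicMeasure, hz, Measure.map_const]

theorem norm_integral_harmonicMeasure_comp_sub_sub_le (hz : 0 < z.re) {f : ℝ → E}
    (hf : AEStronglyMeasurable f volume) {c : ℝ} (hc : ∀ᵐ t, ‖f t‖ ≤ c) (s : ℝ) :
    ‖∫ t, f (t - s) ∂harmonicMeasure z - ∫ t, f t ∂harmonicMeasure z‖ ≤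
      min 2 (|s| / z.re) * c := by
  have hac := harmonicMeasure_absolutelyContinuous hz
  have hc₀ : 0 ≤ c := hc.exists.elim fun t ht => (norm_nonneg _).trans ht
  rw [min_mul_of_nonneg _ _ hc₀, le_min_iff]
  constructor
  · have hle (r : ℝ) : ‖∫ t, f (t - r) ∂harmonicMeasure z‖ ≤ c := by
      have hr := (measurePreserving_sub_right volume r).quasiMeasurePreserving.ae hc
      simpa using norm_integral_le_of_norm_le_const (hac.ae_le hr)
    calc _ ≤ c + c := (norm_sub_le _ _).trans (add_le_add (hle s) (by simpa using hle 0))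
      _ = 2 * c := (two_mul c).symm
  · have haff := quasiMeasurePreserving_affine z.im hz.ne'
    have hbound := norm_integral_stdCauchy_comp_sub_sub_le
      (hf.comp_quasiMeasurePreserving haff) (haff.ae hc) (s / z.re)
    have harg (u : ℝ) : z.im + z.re * (u - s / z.re) = z.im + z.re * u - s := by
      field_simp
      ring
    simpa only [integral_harmonicMeasure hz, Function.comp_apply, harg, abs_div,
      abs_of_pos hz] using hbound

end HarmonicMeasure

/-! ### Poisson representation of bounded analytic functions -/

theorem isOpen_rightHalfPlane : IsOpen rightHalfPlane :=
  isOpen_lt continuous_const Complex.continuous_re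

theorem convex_rightHalfPlane : Convex ℝ rightHalfPlane :=
  convex_halfSpace_re_gt 0

theorem closure_rightHalfPlane : closure rightHalfPlane = {z | 0 ≤ z.re} :=
  Complex.closure_setOfPred_lt_re 0

/-- The Cayley transform, an involution that exchanges the unit disk and the right half plane. -/
noncomputable def cayley (w : ℂ) : ℂ := (1 - w) / (1 + w)

section Cayley

variable {w : ℂ}

theorem one_add_ne_zero_of_neg_one_lt_re (hw : -1 < w.re) : 1 + w ≠ 0 := fun h => by
  have := congrArg Complex.re h
  simp only [Complex.add_re, Complex.one_re, Complex.zero_re] at this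
  linarith

theorem one_add_ne_zero_of_norm_lt_one (hw : ‖w‖ < 1) : 1 + w ≠ 0 :=
  one_add_ne_zero_of_neg_one_lt_re
    (by linarith [neg_le_of_abs_le (Complex.abs_re_le_norm w)])

theorem one_add_cayley (hw : 1 + w ≠ 0) : 1 + cayley w = 2 / (1 + w) := by
  rw [cayley]
  field_simp
  ring

theorem one_add_cayley_ne_zero (hw : 1 + w ≠ 0) : 1 + cayley w ≠ 0 := by
  rw [one_add_cayley hw]
  exact div_ne_zero two_ne_zero hw

theorem cayley_cayley (hw : 1 + w ≠ 0) : cayley (cayley w) = w := by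
  rw [cayley, one_add_cayley hw, cayley]
  field_simp
  ring

theorem hasDerivAt_cayley (hw : 1 + w ≠ 0) : HasDerivAt cayley (-2 / (1 + w) ^ 2) w := by
  refine (((hasDerivAt_id w).const_sub 1).div ((hasDerivAt_id w).const_add 1) hw).congr_deriv ?_
  simp only [id]
  ring

theorem re_cayley (w : ℂ) : (cayley w).re = (1 - ‖w‖ ^ 2) / ‖1 + w‖ ^ 2 := by
  rw [cayley, Complex.div_re, ← add_div, Complex.sq_norm, Complex.sq_norm]
  congr 1
  simp [Complex.normSq_apply]
  ring

theorem re_cayley_pos_iff (hw : 1 + w ≠ 0) : 0 < (cayley w).re ↔ ‖w‖ < 1 := by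
  have hpos : 0 < ‖1 + w‖ ^ 2 := by positivity
  rw [re_cayley, div_pos_iff_of_pos_right hpos, sub_pos, sq_lt_one_iff₀ (norm_nonneg w)]

theorem mapsTo_cayley_ball : Set.MapsTo cayley (Metric.ball 0 1) rightHalfPlane := fun w hw => by
  rw [mem_ball_zero_iff] at hw
  exact (re_cayley_pos_iff (one_add_ne_zero_of_norm_lt_one hw)).2 hw

theorem mapsTo_cayley_rightHalfPlane :
    Set.MapsTo cayley rightHalfPlane (Metric.ball 0 1) := fun w (hw : 0 < w.re) => by
  have hne : 1 + w ≠ 0 := one_add_ne_zero_of_neg_one_lt_re (by linarith)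
  rwa [mem_ball_zero_iff, ← re_cayley_pos_iff (one_add_cayley_ne_zero hne), cayley_cayley hne]

theorem differentiableOn_cayley : DifferentiableOn ℂ cayley (Metric.ball 0 1) := fun _ hw =>
  (hasDerivAt_cayley (one_add_ne_zero_of_norm_lt_one
    (mem_ball_zero_iff.1 hw))).differentiableAt.differentiableWithinAt

theorem one_add_mul_I_ne_zero (u : ℝ) : 1 + u * Complex.I ≠ 0 :=
  one_add_ne_zero_of_neg_one_lt_re (by simp)

theorem cayley_mul_I (u : ℝ) :
    cayley (u * Complex.I) = Complex.exp ((-2 * Real.arctan u : ℝ) * Complex.I) := by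
  set θ := Real.arctan u with hθ
  have hcos : Complex.cos θ ≠ 0 := by
    exact_mod_cast (Real.cos_arctan_pos u).ne'
  have htan : (u : ℂ) = Complex.sin θ / Complex.cos θ := by
    rw [← Real.tan_arctan u, ← hθ, Complex.ofReal_tan, Complex.tan]
  have hplus : 1 + u * Complex.I = Complex.exp (θ * Complex.I) / Complex.cos θ := by
    rw [Complex.exp_mul_I, htan]
    field_simp
  have hminus : 1 - u * Complex.I = Complex.exp (-θ * Complex.I) / Complex.cos θ := by
    rw [Complex.exp_mul_I, Complex.cos_neg, Complex.sin_neg, htan]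
    field_simp
    ring
  rw [cayley, hplus, hminus, div_div_div_cancel_right₀ hcos, ← Complex.exp_sub]
  congr 1
  push_cast
  ring

theorem norm_cayley_mul_I (u : ℝ) : ‖cayley (u * Complex.I)‖ = 1 := by
  rw [cayley_mul_I, Complex.norm_exp_ofReal_mul_I]

theorem continuous_cayley_mul_I : Continuous fun u : ℝ => cayley (u * Complex.I) := by
  simp only [cayley_mul_I]
  fun_prop

theorem mul_cayley_mul_I_mem_ball {r : ℝ} (hr : r ∈ Set.Ioo 0 1) (u : ℝ) :
    r * cayley (u * Complex.I) ∈ Metric.ball (0 : ℂ) 1 := by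
  rw [mem_ball_zero_iff, norm_mul, norm_cayley_mul_I, mul_one, Complex.norm_real,
    Real.norm_of_nonneg hr.1.le]
  exact hr.2

theorem tendsto_cayley_mul_cayley_mul_I (u : ℝ) :
    Tendsto (fun r : ℝ => cayley (r * cayley (u * Complex.I))) (𝓝[<] 1)
      (𝓝[rightHalfPlane] (u * Complex.I)) := by
  refine tendsto_nhdsWithin_iff.2 ⟨?_, ?_⟩
  · have hcont : ContinuousAt (fun r : ℝ => cayley (r * cayley (u * Complex.I))) 1 := by
      have hne := one_add_cayley_ne_zero (one_add_mul_I_ne_zero u)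
      refine ContinuousAt.comp (g := cayley) ?_ (by fun_prop)
      exact (hasDerivAt_cayley (by simpa using hne)).continuousAt
    have hlim := hcont.tendsto
    rw [Complex.ofReal_one, one_mul, cayley_cayley (one_add_mul_I_ne_zero u)] at hlim
    exact hlim.mono_left nhdsWithin_le_nhds
  · filter_upwards [Ioo_mem_nhdsLT zero_lt_one] with r hr
    exact mapsTo_cayley_ball (mul_cayley_mul_I_mem_ball hr u)

end Cayley

section PoissonRepresentation

variable {E : Type*} [NormedAddCommGroup E] [NormedSpace ℂ E]

theorem circleAverage_eq_integral_stdCauchy (f : ℂ → E) (r : ℝ) :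
    Real.circleAverage f 0 r = ∫ u : ℝ, f (r * cayley (u * Complex.I)) ∂stdCauchy := by
  have hmap (u : ℝ) : r * cayley (u * Complex.I) = circleMap 0 r (-2 * Real.arctan u) := by
    rw [cayley_mul_I, circleMap_zero]
  simp only [hmap]
  rw [integral_stdCauchy_comp_arctan fun θ => f (circleMap 0 r (-2 * θ)),
    intervalIntegral.integral_comp_mul_left (fun θ => f (circleMap 0 r θ)) (by norm_num),
    intervalIntegral.integral_symm, Real.circleAverage_eq_integral_add (-Real.pi),
    intervalIntegral.integral_comp_add_right fun θ => f (circleMap 0 r θ)]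
  rw [smul_neg, ← neg_smul, smul_smul]
  congr 2 <;> ring

variable [CompleteSpace E] {K : ℂ → E} {C : ℝ}

theorem apply_one_eq_integral_stdCauchy (hK : DiffContOnCl ℂ K rightHalfPlane)
    (hb : ∀ z ∈ rightHalfPlane, ‖K z‖ ≤ C) :
    K 1 = ∫ u : ℝ, K (u * Complex.I) ∂stdCauchy := by
  have hd : DifferentiableOn ℂ (K ∘ cayley) (Metric.ball 0 1) :=
    hK.differentiableOn.comp differentiableOn_cayley mapsTo_cayley_ball
  have hmean {r : ℝ} (hr : r ∈ Set.Ioo 0 1) :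
      K 1 = ∫ u : ℝ, K (cayley (r * cayley (u * Complex.I))) ∂stdCauchy := by
    have hsub : Metric.closedBall (0 : ℂ) |r| ⊆ Metric.ball 0 1 := by
      rw [abs_of_pos hr.1]
      exact Metric.closedBall_subset_ball hr.2
    have havg := ((hd.mono hsub).diffContOnCl_ball subset_rfl).circleAverage
    rw [circleAverage_eq_integral_stdCauchy] at havg
    simpa [cayley] using havg.symm
  have hr : ∀ᶠ r : ℝ in 𝓝[<] 1, r ∈ Set.Ioo 0 1 := Ioo_mem_nhdsLT zero_lt_one
  refine tendsto_nhds_unique (tendsto_const_nhds.congr' (hr.mono fun r hr => hmean hr)) ?_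
  refine tendsto_integral_filter_of_dominated_convergence (fun _ => C) ?_ ?_
    (integrable_const C) (Eventually.of_forall fun u => ?_)
  · refine hr.mono fun r hr => Continuous.aestronglyMeasurable ?_
    exact hd.continuousOn.comp_continuous (continuous_const.mul continuous_cayley_mul_I)
      (mul_cayley_mul_I_mem_ball hr)
  · exact hr.mono fun r hr => Eventually.of_forall fun u =>
      hb _ (mapsTo_cayley_ball (mul_cayley_mul_I_mem_ball hr u))
  · have hu : (u * Complex.I : ℂ) ∈ closure rightHalfPlane := by simp [closure_rightHalfPlane]
    exact ((hK.continuousOn _ hu).mono subset_closure).tendsto.comp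
      (tendsto_cayley_mul_cayley_mul_I u)

theorem eq_integral_harmonicMeasure_of_diffContOnCl (hK : DiffContOnCl ℂ K rightHalfPlane)
    (hb : ∀ z ∈ rightHalfPlane, ‖K z‖ ≤ C) {z : ℂ} (hz : z ∈ rightHalfPlane) :
    K z = ∫ t : ℝ, K (t * Complex.I) ∂harmonicMeasure z := by
  have hmaps : Set.MapsTo (fun w : ℂ => z.im * Complex.I + z.re * w) rightHalfPlane
      rightHalfPlane := fun _ hw => by
    simpa [rightHalfPlane] using mul_pos hz hw
  have hcomp : DiffContOnCl ℂ (fun w => K (z.im * Complex.I + z.re * w)) rightHalfPlane :=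
    hK.comp (Differentiable.diffContOnCl (by fun_prop)) hmaps
  have hmean := apply_one_eq_integral_stdCauchy hcomp fun w hw => hb _ (hmaps hw)
  rw [mul_one, add_comm, Complex.re_add_im] at hmean
  rw [hmean, integral_harmonicMeasure hz]
  congr 1 with u
  push_cast
  ring_nf

theorem eq_integral_harmonicMeasure_of_tendsto (hK : DifferentiableOn ℂ K rightHalfPlane)
    (hb : ∀ z ∈ rightHalfPlane, ‖K z‖ ≤ C) {k : ℝ → E}
    (hk : ∀ᵐ t : ℝ, Tendsto (fun ε : ℝ => K (ε + t * Complex.I)) (𝓝[>] 0) (𝓝 (k t)))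
    {z : ℂ} (hz : z ∈ rightHalfPlane) : K z = ∫ t, k t ∂harmonicMeasure z := by
  have hmem {ε : ℝ} (hε : 0 < ε) {w : ℂ} (hw : 0 ≤ w.re) : ε + w ∈ rightHalfPlane := by
    simpa [rightHalfPlane] using add_pos_of_pos_of_nonneg hε hw
  have hmemI {ε : ℝ} (hε : 0 < ε) (t : ℝ) : ε + t * Complex.I ∈ rightHalfPlane :=
    hmem hε (by simp)
  have hshift {ε : ℝ} (hε : 0 < ε) :
      K (ε + z) = ∫ t : ℝ, K (ε + t * Complex.I) ∂harmonicMeasure z := by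
    have hdiff : DifferentiableOn ℂ (fun w => K (ε + w)) (closure rightHalfPlane) :=
      hK.comp (by fun_prop) fun w hw => hmem hε (closure_rightHalfPlane.subset hw)
    exact eq_integral_harmonicMeasure_of_diffContOnCl hdiff.diffContOnCl
      (fun w (hw : 0 < w.re) => hb _ (hmem hε hw.le)) hz
  have hleft : Tendsto (fun ε : ℝ => K (ε + z)) (𝓝[>] 0) (𝓝 (K z)) := by
    have hKz : ContinuousAt K ((0 : ℝ) + z) := by
      simpa using (hK.differentiableAt (isOpen_rightHalfPlane.mem_nhds hz)).continuousAt
    have hlim := (ContinuousAt.comp (f := fun ε : ℝ => (ε + z : ℂ)) hKz (by fun_prop)).tendsto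
    simpa [Function.comp_def] using hlim.mono_left nhdsWithin_le_nhds
  have hpos : ∀ᶠ ε : ℝ in 𝓝[>] 0, 0 < ε := self_mem_nhdsWithin
  refine tendsto_nhds_unique (hleft.congr' (hpos.mono fun ε hε => hshift hε)) ?_
  refine tendsto_integral_filter_of_dominated_convergence (fun _ => C) ?_ ?_
    (integrable_const C) ((harmonicMeasure_absolutelyContinuous hz).ae_le hk)
  · exact hpos.mono fun ε hε => (hK.continuousOn.comp_continuous (by fun_prop)
      (hmemI hε)).aestronglyMeasurable
  · exact hpos.mono fun ε hε => Eventually.of_forall fun t => hb _ (hmemI hε t)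

end PoissonRepresentation

/-! ### Nontangential boundary values -/

theorem isExactOn_rightHalfPlane {E : Type*} [NormedAddCommGroup E] [NormedSpace ℂ E]
    [CompleteSpace E] {φ : ℂ → E} (hφ : DifferentiableOn ℂ φ rightHalfPlane) :
    Complex.IsExactOn φ rightHalfPlane := by
  have hpull : DifferentiableOn ℂ (fun w => (-2 / (1 + w) ^ 2) • φ (cayley w))
      (Metric.ball 0 1) := by
    refine DifferentiableOn.fun_smul (fun w hw => ?_)
      (hφ.comp differentiableOn_cayley mapsTo_cayley_ball)
    have hne := one_add_ne_zero_of_norm_lt_one (mem_ball_zero_iff.1 hw)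
    exact DifferentiableWithinAt.fun_div (by fun_prop) (by fun_prop) (pow_ne_zero 2 hne)
  obtain ⟨F, hF⟩ := hpull.isExactOn_ball
  refine ⟨F ∘ cayley, fun z hz => ?_⟩
  have hne : 1 + z ≠ 0 :=
    one_add_ne_zero_of_neg_one_lt_re (neg_one_lt_zero.trans (show 0 < z.re from hz))
  refine ((hF _ (mapsTo_cayley_rightHalfPlane hz)).scomp z
    (hasDerivAt_cayley hne)).congr_deriv ?_
  simp only [cayley_cayley hne, one_add_cayley hne, smul_smul]
  have hcancel : -2 / (1 + z) ^ 2 * (-2 / (2 / (1 + z)) ^ 2) = 1 := by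
    field_simp
  rw [hcancel, one_smul]

theorem exists_lipschitzWith_hasDerivAt {φ : ℂ → ℂ} {C : ℝ}
    (hφ : DifferentiableOn ℂ φ rightHalfPlane) (hb : ∀ z ∈ rightHalfPlane, ‖φ z‖ ≤ C) :
    ∃ G : ℂ → ℂ, (∃ L, LipschitzWith L G) ∧ ∀ z ∈ rightHalfPlane, HasDerivAt G (φ z) z := by
  obtain ⟨F, hF⟩ := isExactOn_rightHalfPlane hφ
  have hlip : LipschitzOnWith C.toNNReal F rightHalfPlane :=
    convex_rightHalfPlane.lipschitzOnWith_of_nnnorm_hasDerivWithin_le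
      (fun z hz => (hF z hz).hasDerivWithinAt)
      fun z hz => NNReal.coe_le_coe.1 ((hb z hz).trans (Real.le_coe_toNNReal C))
  obtain ⟨G, hG, hFG⟩ := hlip.extend_finite_dimension
  exact ⟨G, ⟨_, hG⟩, fun z hz => (hF z hz).congr_of_eventuallyEq
    (hFG.symm.eventuallyEq_of_mem (isOpen_rightHalfPlane.mem_nhds hz))⟩

section BoundaryDerivative

variable {L : NNReal}

section Slope

variable {𝕜 F : Type*} [NontriviallyNormedField 𝕜] [NormedAddCommGroup F] [NormedSpace 𝕜 F]
  {f : 𝕜 → F}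

theorem norm_slope_le_of_lipschitzWith (hL : LipschitzWith L f) (x y : 𝕜) :
    ‖slope f x y‖ ≤ L := by
  rw [slope_def_module, norm_smul, norm_inv, mul_comm, ← div_eq_mul_inv, ← dist_eq_norm,
    ← dist_eq_norm]
  exact div_le_of_le_mul₀ dist_nonneg L.2 (hL.dist_le_mul y x)

theorem norm_dslope_le_of_lipschitzWith (hL : LipschitzWith L f) (x y : 𝕜) :
    ‖dslope f x y‖ ≤ L := by
  rcases eq_or_ne y x with rfl | hne
  · rw [dslope_same]
    exact norm_deriv_le_of_lipschitz hL
  · rw [dslope_of_ne f hne]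
    exact norm_slope_le_of_lipschitzWith hL x y

end Slope

theorem lipschitzWith_comp_mul_I {X : Type*} [PseudoMetricSpace X] {G : ℂ → X}
    (hL : LipschitzWith L G) : LipschitzWith L fun t : ℝ => G (t * Complex.I) := by
  refine LipschitzWith.of_dist_le_mul fun s t => (hL.dist_le_mul _ _).trans_eq ?_
  rw [dist_eq_norm, ← sub_mul, norm_mul, Complex.norm_I, mul_one, ← Complex.ofReal_sub,
    Complex.norm_real, dist_eq_norm]

variable {E : Type*} [NormedAddCommGroup E] [NormedSpace ℂ E]

theorem slope_mul_I (G : ℂ → E) (s t : ℝ) :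
    slope G (s * Complex.I) (t * Complex.I) =
      -Complex.I • slope (fun r : ℝ => G (r * Complex.I)) s t := by
  rw [slope_def_module, slope_def_module, ← sub_mul, mul_inv_rev, Complex.inv_I, mul_smul,
    ← Complex.ofReal_sub, ← Complex.ofReal_inv, Complex.coe_smul]

theorem mul_I_notMem_rightHalfPlane (t : ℝ) : (t * Complex.I : ℂ) ∉ rightHalfPlane := by
  simp [rightHalfPlane]

variable [CompleteSpace E] {G : ℂ → E} {t : ℝ}

theorem slope_eq_integral_harmonicMeasure (hL : LipschitzWith L G)
    (hG : DifferentiableOn ℂ G rightHalfPlane) {w : ℂ} (hw : w ∈ rightHalfPlane) :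
    slope G (t * Complex.I) w =
      ∫ s, -Complex.I • dslope (fun r : ℝ => G (r * Complex.I)) t s ∂harmonicMeasure w := by
  have hslope : DifferentiableOn ℂ (slope G (t * Complex.I)) rightHalfPlane :=
    ((differentiableOn_dslope_of_notMem (mul_I_notMem_rightHalfPlane t)).2 hG).congr
      fun z hz => (dslope_of_ne G (ne_of_mem_of_not_mem hz (mul_I_notMem_rightHalfPlane t))).symm
  refine eq_integral_harmonicMeasure_of_tendsto hslope
    (fun z _ => norm_slope_le_of_lipschitzWith hL _ z) ?_ hw
  filter_upwards [Measure.ae_ne volume t] with s hs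
  have hsI : (s * Complex.I : ℂ) ≠ t * Complex.I := by simpa using hs
  have hcont : ContinuousAt (slope G (t * Complex.I)) (((0 : ℝ) : ℂ) + s * Complex.I) := by
    rw [Complex.ofReal_zero, zero_add]
    exact ((continuousAt_dslope_of_ne hsI).2 hL.continuous.continuousAt).congr
      ((eventually_ne_nhds hsI).mono fun z hz => dslope_of_ne G hz)
  have hlim := (ContinuousAt.comp (f := fun ε : ℝ => (ε + s * Complex.I : ℂ)) hcont
    (by fun_prop)).tendsto
  rw [Function.comp_apply, Complex.ofReal_zero, zero_add, slope_mul_I,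
    ← dslope_of_ne _ hs] at hlim
  exact hlim.mono_left nhdsWithin_le_nhds

theorem hasDerivWithinAt_mul_I (hL : LipschitzWith L G)
    (hG : DifferentiableOn ℂ G rightHalfPlane)
    (hd : DifferentiableAt ℝ (fun r : ℝ => G (r * Complex.I)) t) :
    HasDerivWithinAt G (-Complex.I • deriv (fun r : ℝ => G (r * Complex.I)) t) rightHalfPlane
      (t * Complex.I) := by
  have hgL := lipschitzWith_comp_mul_I hL
  set k : ℝ → E := fun s => -Complex.I • dslope (fun r : ℝ => G (r * Complex.I)) t s with hk
  have hkc : Continuous k := by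
    refine Continuous.const_smul (continuousOn_univ.1 ?_) _
    exact (continuousOn_dslope univ_mem).2 ⟨hgL.continuous.continuousOn, hd⟩
  have hkb (s : ℝ) : ‖k s‖ ≤ L := by
    rw [norm_smul, norm_neg, Complex.norm_I, one_mul]
    exact norm_dslope_le_of_lipschitzWith hgL t s
  have hlim := (continuous_integral_harmonicMeasure hkc hkb).tendsto (t * Complex.I)
  rw [harmonicMeasure_of_re_eq_zero (by simp), integral_dirac] at hlim
  have hkt : k (t * Complex.I : ℂ).im = -Complex.I • deriv (fun r : ℝ => G (r * Complex.I)) t := by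
    simp [hk]
  rw [hasDerivWithinAt_iff_tendsto_slope' (mul_I_notMem_rightHalfPlane t), ← hkt]
  refine (hlim.mono_left nhdsWithin_le_nhds).congr' ?_
  filter_upwards [self_mem_nhdsWithin] with w hw
    using (slope_eq_integral_harmonicMeasure hL hG hw).symm

end BoundaryDerivative

section ApproachRegion

variable {M y : ℝ} {z : ℂ}

theorem approachRegion_subset_rightHalfPlane : approachRegion M y ⊆ rightHalfPlane :=
  fun _ hz => hz.1

theorem norm_sub_mul_I_le_of_mem_approachRegion (hz : z ∈ approachRegion M y) :
    ‖z - y * Complex.I‖ ≤ (1 + M) * z.re := by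
  calc ‖z - y * Complex.I‖ ≤ |(z - y * Complex.I).re| + |(z - y * Complex.I).im| :=
        Complex.norm_le_abs_re_add_abs_im _
    _ = z.re + |z.im - y| := by simp [abs_of_pos hz.1]
    _ ≤ (1 + M) * z.re := by linarith [hz.2]

theorem re_le_norm_sub_mul_I (z : ℂ) (y : ℝ) : z.re ≤ ‖z - y * Complex.I‖ := by
  simpa using Complex.re_le_norm (z - y * Complex.I)

theorem closedBall_half_re_subset_rightHalfPlane (hz : z ∈ rightHalfPlane) :
    Metric.closedBall z (z.re / 2) ⊆ rightHalfPlane := fun w hw => by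
  have hre := Complex.re_le_norm (z - w)
  rw [mem_closedBall_iff_norm'] at hw
  rw [Complex.sub_re] at hre
  change 0 < w.re
  linarith [show 0 < z.re from hz]

variable {E : Type*} [NormedAddCommGroup E] [NormedSpace ℂ E]

theorem norm_deriv_le_of_norm_le_mul_norm_sub {D : ℂ → E}
    (hD : DifferentiableOn ℂ D rightHalfPlane) (hz : z ∈ approachRegion M y) {c : ℝ}
    (hc : ∀ w ∈ rightHalfPlane, ‖w - y * Complex.I‖ ≤ 2 * ‖z - y * Complex.I‖ →
      ‖D w‖ ≤ c * ‖z - y * Complex.I‖) :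
    ‖deriv D z‖ ≤ 2 * c * (1 + M) := by
  have hre : 0 < z.re := hz.1
  have hball := closedBall_half_re_subset_rightHalfPlane hre
  have hlower := re_le_norm_sub_mul_I z y
  have hDz := hc z hre (by linarith [norm_nonneg (z - y * Complex.I)])
  have hc₀ : 0 ≤ c := nonneg_of_mul_nonneg_left ((norm_nonneg _).trans hDz) (hre.trans_le hlower)
  have hcauchy := Complex.norm_deriv_le_of_forall_mem_sphere_norm_le (half_pos hre)
    ((hD.mono hball).diffContOnCl_ball subset_rfl) (C := c * ‖z - y * Complex.I‖) fun w hw => by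
      refine hc w (hball (Metric.sphere_subset_closedBall hw)) ?_
      have htri := norm_sub_le_norm_sub_add_norm_sub w z (y * Complex.I)
      rw [mem_sphere_iff_norm.1 hw] at htri
      linarith
  calc ‖deriv D z‖ ≤ c * ‖z - y * Complex.I‖ / (z.re / 2) := hcauchy
    _ ≤ c * ((1 + M) * z.re) / (z.re / 2) := by
        gcongr
        exact norm_sub_mul_I_le_of_mem_approachRegion hz
    _ = 2 * c * (1 + M) := by field_simp

theorem tendsto_deriv_approachRegion {G : ℂ → E} {a : E}
    (hG : DifferentiableOn ℂ G rightHalfPlane)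
    (ha : HasDerivWithinAt G a rightHalfPlane (y * Complex.I)) (M : ℝ) :
    Tendsto (deriv G) (𝓝[approachRegion M y] (y * Complex.I)) (𝓝 a) := by
  set b : ℂ := y * Complex.I
  set D : ℂ → E := fun w => G w - G b - (w - b) • a
  have hderiv {w : ℂ} (hw : w ∈ rightHalfPlane) : HasDerivAt D (deriv G w - a) w := by
    have hGw := (hG.differentiableAt (isOpen_rightHalfPlane.mem_nhds hw)).hasDerivAt
    simpa only [one_smul, id] using
      (hGw.sub_const (G b)).fun_sub (((hasDerivAt_id w).sub_const b).smul_const a)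
  rw [Metric.tendsto_nhds]
  intro ε hε
  set c := ε / (8 * (1 + |M|)) with hc
  have hc₀ : 0 < c := by positivity
  have hlittle : ∀ᶠ w in 𝓝[rightHalfPlane] b, ‖D w‖ ≤ c * ‖w - b‖ :=
    (hasDerivWithinAt_iff_isLittleO.1 ha).def hc₀
  obtain ⟨δ, hδ, hDle⟩ := Metric.mem_nhdsWithin_iff.1 hlittle
  filter_upwards [self_mem_nhdsWithin, mem_nhdsWithin_of_mem_nhds
    (Metric.ball_mem_nhds b (half_pos hδ))] with z hz hzδ
  rw [mem_ball_iff_norm] at hzδ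
  have hbound := norm_deriv_le_of_norm_le_mul_norm_sub (c := 2 * c) (D := D)
    (fun w hw => (hderiv hw).differentiableAt.differentiableWithinAt) hz fun w hw hwz => by
      calc ‖D w‖ ≤ c * ‖w - b‖ := hDle ⟨mem_ball_iff_norm.2 (by linarith), hw⟩
        _ ≤ c * (2 * ‖z - b‖) := by gcongr
        _ = 2 * c * ‖z - b‖ := by ring
  rw [(hderiv hz.1).deriv] at hbound
  calc dist (deriv G z) a = ‖deriv G z - a‖ := dist_eq_norm _ _
    _ ≤ 2 * (2 * c) * (1 + M) := hbound
    _ ≤ 2 * (2 * c) * (1 + |M|) := by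
        gcongr
        exact le_abs_self M
    _ = ε / 2 := by
        rw [hc]
        field_simp
        norm_num
    _ < ε := half_lt_self hε

theorem exists_tendsto_approachRegion {φ : ℂ → ℂ} {C : ℝ}
    (hφ : DifferentiableOn ℂ φ rightHalfPlane) (hb : ∀ z ∈ rightHalfPlane, ‖φ z‖ ≤ C) :
    ∃ k : ℝ → ℂ, ∀ᵐ y : ℝ, ∀ M : ℝ,
      Tendsto φ (𝓝[approachRegion M y] (y * Complex.I)) (𝓝 (k y)) := by
  obtain ⟨G, ⟨L, hL⟩, hG⟩ := exists_lipschitzWith_hasDerivAt hφ hb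
  have hGd : DifferentiableOn ℂ G rightHalfPlane := fun z hz =>
    (hG z hz).differentiableAt.differentiableWithinAt
  refine ⟨fun y => -Complex.I • deriv (fun r : ℝ => G (r * Complex.I)) y, ?_⟩
  filter_upwards [(lipschitzWith_comp_mul_I hL).ae_differentiableAt_real] with y hy M
  refine (tendsto_deriv_approachRegion hGd (hasDerivWithinAt_mul_I hL hGd hy) M).congr' ?_
  filter_upwards [self_mem_nhdsWithin] with z hz using (hG z hz.1).deriv

theorem tendsto_add_mul_I_approachRegion (hM : 0 < M) (y : ℝ) :
    Tendsto (fun ε : ℝ => (ε + y * Complex.I : ℂ)) (𝓝[>] 0)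
      (𝓝[approachRegion M y] (y * Complex.I)) := by
  refine tendsto_nhdsWithin_iff.2 ⟨?_, ?_⟩
  · have hcont : Continuous fun ε : ℝ => (ε + y * Complex.I : ℂ) := by fun_prop
    simpa using (hcont.tendsto 0).mono_left nhdsWithin_le_nhds
  · filter_upwards [self_mem_nhdsWithin] with ε (hε : 0 < ε)
    simpa [approachRegion, hε] using mul_pos hM hε

theorem tendsto_comap_approachRegion_iff {X : Type*} {f : ℂ → X} {l : Filter X} {b : ℂ} :
    Tendsto (fun z : rightHalfPlane => f z) (comap (↑) (𝓝[approachRegion M y] b)) l ↔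
      Tendsto f (𝓝[approachRegion M y] b) l := by
  refine tendsto_comap'_iff (i := ((↑) : rightHalfPlane → ℂ)) ?_
  rw [Subtype.range_coe]
  exact mem_of_superset self_mem_nhdsWithin approachRegion_subset_rightHalfPlane

end ApproachRegion

theorem exists_differentiableOn_extension (φ : HInfty) :
    ∃ g : ℂ → ℂ, DifferentiableOn ℂ g rightHalfPlane ∧
      (∀ z ∈ rightHalfPlane, ‖g z‖ ≤ ‖(φ : rightHalfPlane →ᵇ ℂ)‖) ∧
      ⇑(φ : rightHalfPlane →ᵇ ℂ) = fun z : rightHalfPlane => g z := by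
  obtain ⟨g, hg, hφ⟩ := φ.2
  exact ⟨g, hg, fun z hz => hφ ⟨z, hz⟩ ▸ BoundedContinuousFunction.norm_coe_le_norm _ _,
    funext hφ⟩

theorem exists_isBoundaryFunction (φ : HInfty) : ∃ ψ : LInfty, IsBoundaryFunction φ ψ := by
  obtain ⟨g, hg, hb, hφ⟩ := exists_differentiableOn_extension φ
  obtain ⟨k, hk⟩ := exists_tendsto_approachRegion hg hb
  have hlim : ∀ᵐ t : ℝ, Tendsto (fun x : ℝ => g (Real.exp x + t * Complex.I)) atBot
      (𝓝 (k t)) := hk.mono fun t ht =>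
    ((ht 1).comp (tendsto_add_mul_I_approachRegion one_pos t)).comp Real.tendsto_exp_atBot_nhdsGT
  have hmem (x t : ℝ) : (Real.exp x + t * Complex.I : ℂ) ∈ rightHalfPlane := by
    simpa [rightHalfPlane, ← Complex.ofReal_exp] using Real.exp_pos x
  have hmeas : AEStronglyMeasurable k volume := by
    refine aestronglyMeasurable_of_tendsto_ae atBot (fun x => ?_) hlim
    exact (hg.continuousOn.comp_continuous (by fun_prop) (hmem x)).aestronglyMeasurable
  have hbound : ∀ᵐ t : ℝ, ‖k t‖ ≤ ‖(φ : rightHalfPlane →ᵇ ℂ)‖ := hlim.mono fun t ht =>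
    le_of_tendsto ht.norm (Eventually.of_forall fun x => hb _ (hmem x t))
  have hkLp : MemLp k ∞ volume := memLp_top_of_bound hmeas _ hbound
  refine ⟨hkLp.toLp k, ?_⟩
  filter_upwards [hk, hkLp.coeFn_toLp] with y hy hψ M
  rw [hψ, hφ]
  exact tendsto_comap_approachRegion_iff.2 (hy M)

theorem IsBoundaryFunction.eq_integral_harmonicMeasure {φ : HInfty} {ψ : LInfty}
    (hψ : IsBoundaryFunction φ ψ) (z : rightHalfPlane) :
    (φ : rightHalfPlane →ᵇ ℂ) z = ∫ t, ψ t ∂harmonicMeasure z := by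
  obtain ⟨g, hg, hb, hφ⟩ := exists_differentiableOn_extension φ
  rw [hφ]
  refine eq_integral_harmonicMeasure_of_tendsto hg hb (hψ.mono fun y hy => ?_) z.2
  have hlim := hy 1
  rw [hφ, tendsto_comap_approachRegion_iff] at hlim
  exact hlim.comp (tendsto_add_mul_I_approachRegion one_pos y)

/-! ### Means given by integration -/

theorem ae_norm_le_norm (φ : LInfty) : ∀ᵐ t, ‖φ t‖ ≤ ‖φ‖ := by
  filter_upwards [ae_le_eLpNormEssSup (f := φ) (μ := volume)] with t ht
  rw [← eLpNorm_exponent_top, ← Lp.enorm_def] at ht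
  exact enorm_le_iff_norm_le.mp ht

section IntegralCLM

variable {μ : Measure ℝ}

theorem integrable_of_absolutelyContinuous [IsFiniteMeasure μ] (hμ : μ ≪ volume) (φ : LInfty) :
    Integrable φ μ :=
  .of_bound ((Lp.aestronglyMeasurable φ).mono_ac hμ) ‖φ‖ (hμ.ae_le (ae_norm_le_norm φ))

theorem integrable_convolution_integrand [IsFiniteMeasure μ] (hμ : μ ≪ volume)
    {f : ℝ → ℝ} (hf : Integrable f) (φ : LInfty) :
    Integrable (fun q : ℝ × ℝ => f q.2 • φ (q.1 - q.2)) (μ.prod volume) := by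
  have hsub : Measure.QuasiMeasurePreserving (fun q : ℝ × ℝ => q.1 - q.2) (μ.prod volume) :=
    (quasiMeasurePreserving_sub volume volume).mono_left (hμ.prod .rfl)
  exact (hf.comp_snd μ).smul_bdd ‖φ‖
    ((Lp.aestronglyMeasurable φ).comp_quasiMeasurePreserving hsub) (hsub.ae (ae_norm_le_norm φ))

variable [IsProbabilityMeasure μ]

/-- Integration against a probability measure `μ ≪ volume`, as a functional on `L^∞(ℝ)`. -/
noncomputable def integralCLM (μ : Measure ℝ) [IsProbabilityMeasure μ] (hμ : μ ≪ volume) :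
    StrongDual ℂ LInfty :=
  LinearMap.mkContinuous
    { toFun := fun φ => ∫ t, φ t ∂μ
      map_add' := fun φ ψ => by
        rw [integral_congr_ae (hμ.ae_le (Lp.coeFn_add φ ψ))]
        exact integral_add (integrable_of_absolutelyContinuous hμ φ)
          (integrable_of_absolutelyContinuous hμ ψ)
      map_smul' := fun c φ => by
        rw [integral_congr_ae (hμ.ae_le (Lp.coeFn_smul c φ))]
        exact integral_smul c _ }
    1 fun φ => by
      simpa using norm_integral_le_of_norm_le_const (hμ.ae_le (ae_norm_le_norm φ))

theorem integralCLM_apply (hμ : μ ≪ volume) (φ : LInfty) :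
    integralCLM μ hμ φ = ∫ t, φ t ∂μ := rfl

theorem norm_integralCLM_le (hμ : μ ≪ volume) : ‖integralCLM μ hμ‖ ≤ 1 :=
  LinearMap.mkContinuous_norm_le _ zero_le_one _

theorem isMean_integralCLM (hμ : μ ≪ volume) : IsMean (integralCLM μ hμ) where
  nonneg _ hφ := integral_nonneg_of_ae (hμ.ae_le hφ)
  map_one := by
    rw [integralCLM_apply, oneLInfty, integral_congr_ae (hμ.ae_le (MemLp.coeFn_toLp _))]
    simp

theorem integralCLM_conv (hμ : μ ≪ volume) (f : Lp ℝ 1 (volume : Measure ℝ)) (φ : LInfty) :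
    integralCLM μ hμ (conv f φ) = ∫ s, f s • ∫ t, φ (t - s) ∂μ := by
  rw [integralCLM_apply, conv, integral_congr_ae (hμ.ae_le (MemLp.coeFn_toLp _))]
  simp only [convolution_def, ContinuousLinearMap.lsmul_apply]
  rw [integral_integral_swap
    (integrable_convolution_integrand hμ (L1.integrable_coeFn f) φ)]
  simp only [integral_smul]

theorem integralCLM_conv_sub (hμ : μ ≪ volume) {f : Lp ℝ 1 (volume : Measure ℝ)}
    (hf : f ∈ densities) (φ : LInfty) :
    integralCLM μ hμ (conv f φ) - integralCLM μ hμ φ =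
      ∫ s, f s • (∫ t, φ (t - s) ∂μ - ∫ t, φ t ∂μ) := by
  have hfi : Integrable f := L1.integrable_coeFn f
  have hconv : Integrable fun s => f s • ∫ t, φ (t - s) ∂μ := by
    simpa only [integral_smul] using
      (integrable_convolution_integrand hμ hfi φ).integral_prod_right
  simp only [smul_sub]
  rw [integral_sub hconv (hfi.smul_const _), integral_smul_const, hf.2, one_smul,
    integralCLM_conv, integralCLM_apply]

end IntegralCLM

/-- The value at `z` of the Poisson integral of `φ ∈ L^∞(ℝ)`, as a functional of `φ`. -/
noncomputable def poissonFunctional (z : rightHalfPlane) : StrongDual ℂ LInfty :=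
  integralCLM (harmonicMeasure z) (harmonicMeasure_absolutelyContinuous z.2)

theorem integrable_mul_min {f : ℝ → ℝ} (hf : Integrable f) {x : ℝ} (hx : 0 < x) :
    Integrable fun s => ‖f s‖ * min 2 (|s| / x) := by
  refine hf.norm.mul_bdd (c := 2) (Continuous.aestronglyMeasurable (by fun_prop))
    (Eventually.of_forall fun s => ?_)
  rw [Real.norm_of_nonneg (by positivity)]
  exact min_le_left _ _

theorem tendsto_integral_mul_min {f : ℝ → ℝ} (hf : Integrable f) :
    Tendsto (fun x : ℝ => ∫ s, ‖f s‖ * min 2 (|s| / x)) atTop (𝓝 0) := by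
  have hx : ∀ᶠ x : ℝ in atTop, 0 < x := eventually_gt_atTop 0
  rw [← integral_zero ℝ ℝ]
  refine tendsto_integral_filter_of_dominated_convergence (fun s => ‖f s‖ * 2)
    (hx.mono fun x hx => (integrable_mul_min hf hx).aestronglyMeasurable)
    (hx.mono fun x hx => Eventually.of_forall fun s => ?_) (hf.norm.mul_const 2)
    (Eventually.of_forall fun s => ?_)
  · rw [Real.norm_of_nonneg (by positivity)]
    gcongr
    exact min_le_left _ _
  · have hdiv : Tendsto (fun x : ℝ => |s| / x) atTop (𝓝 0) :=
      tendsto_const_nhds.div_atTop tendsto_id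
    simpa using ((tendsto_const_nhds (x := (2 : ℝ))).min hdiv).const_mul ‖f s‖

theorem norm_poissonFunctional_conv_sub_le (z : rightHalfPlane)
    {f : Lp ℝ 1 (volume : Measure ℝ)} (hf : f ∈ densities) (φ : LInfty) :
    ‖poissonFunctional z (conv f φ) - poissonFunctional z φ‖ ≤
      (∫ s, ‖f s‖ * min 2 (|s| / (z : ℂ).re)) * ‖φ‖ := by
  rw [poissonFunctional, integralCLM_conv_sub _ hf, ← integral_mul_const]
  refine norm_integral_le_of_norm_le
    ((integrable_mul_min (L1.integrable_coeFn f) z.2).mul_const _)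
    (Eventually.of_forall fun s => ?_)
  rw [norm_smul, mul_assoc]
  gcongr
  exact norm_integral_harmonicMeasure_comp_sub_sub_le z.2 (Lp.aestronglyMeasurable φ)
    (ae_norm_le_norm φ) s

theorem exists_tendsto_of_norm_le {𝕜 E ι : Type*} [NontriviallyNormedField 𝕜] [ProperSpace 𝕜]
    [SeminormedAddCommGroup E] [NormedSpace 𝕜 E] (U : Ultrafilter ι) {T : ι → StrongDual 𝕜 E}
    {r : ℝ} (hT : ∀ i, ‖T i‖ ≤ r) :
    ∃ Φ : StrongDual 𝕜 E, ∀ x, Tendsto (fun i => T i x) U (𝓝 (Φ x)) := by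
  obtain ⟨Φ, -, hΦ⟩ := (WeakDual.isCompact_closedBall (0 : StrongDual 𝕜 E) r).ultrafilter_le_nhds
    (U.map fun i => StrongDual.toWeakDual (T i)) <| by
      refine le_principal_iff.2 (Eventually.of_forall (f := (U : Filter ι)) fun i => ?_)
      simpa using hT i
  exact ⟨WeakDual.toStrongDual Φ, fun x => ((WeakDual.eval_continuous x).tendsto Φ).comp hΦ⟩

section Limit

variable {ι : Type*} {l : Filter ι} [l.NeBot]

theorem isMean_of_tendsto {T : ι → StrongDual ℂ LInfty} (hT : ∀ i, IsMean (T i))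
    {Φ : StrongDual ℂ LInfty} (hΦ : ∀ φ, Tendsto (fun i => T i φ) l (𝓝 (Φ φ))) : IsMean Φ where
  nonneg φ hφ := ge_of_tendsto' (hΦ φ) fun i => (hT i).nonneg φ hφ
  map_one := tendsto_nhds_unique (hΦ oneLInfty)
    (tendsto_const_nhds.congr fun i => (hT i).map_one.symm)

variable {z : ι → rightHalfPlane}

theorem isTopologicallyInvariantMean_of_tendsto_poissonFunctional
    (hz : Tendsto (fun i => (z i : ℂ).re) l atTop) {Φ : StrongDual ℂ LInfty}
    (hΦ : ∀ φ, Tendsto (fun i => poissonFunctional (z i) φ) l (𝓝 (Φ φ))) :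
    IsTopologicallyInvariantMean Φ where
  toIsMean := isMean_of_tendsto (fun _ => isMean_integralCLM _) hΦ
  map_conv f hf φ := by
    have hbound := ((tendsto_integral_mul_min (L1.integrable_coeFn f)).comp hz).mul_const ‖φ‖
    rw [zero_mul] at hbound
    have hzero := squeeze_zero_norm
      (fun i => norm_poissonFunctional_conv_sub_le (z i) hf φ) hbound
    exact sub_eq_zero.1 (tendsto_nhds_unique ((hΦ (conv f φ)).sub (hΦ φ)) hzero)

theorem exists_isTopologicallyInvariantMean_of_tendsto_re_atTop
    (hz : Tendsto (fun i => (z i : ℂ).re) l atTop) :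
    ∃ Φ : StrongDual ℂ LInfty, IsTopologicallyInvariantMean Φ ∧
      ∀ φ c, Tendsto (fun i => poissonFunctional (z i) φ) l (𝓝 c) → Φ φ = c := by
  have hle : (Ultrafilter.of l : Filter ι) ≤ l := Ultrafilter.of_le l
  obtain ⟨Φ, hΦ⟩ := exists_tendsto_of_norm_le (Ultrafilter.of l)
    (T := fun i => poissonFunctional (z i)) fun _ => norm_integralCLM_le _
  exact ⟨Φ, isTopologicallyInvariantMean_of_tendsto_poissonFunctional (hz.mono_left hle) hΦ,
    fun φ c hc => tendsto_nhds_unique (hΦ φ) (hc.mono_left hle)⟩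

end Limit

theorem IsBoundaryFunction.poissonFunctional_apply {φ : HInfty} {ψ : LInfty}
    (hψ : IsBoundaryFunction φ ψ) (z : rightHalfPlane) :
    poissonFunctional z ψ = pointEval z φ :=
  (hψ.eq_integral_harmonicMeasure z).symm

end HalfPlane

theorem theorem4p3 {ι : Type*} [Preorder ι] [IsDirectedOrder ι] [Nonempty ι]
    (z : ι → HalfPlane.rightHalfPlane) (χ : HalfPlane.MaximalIdealSpace)
    (hz : Tendsto (fun α => (z α : ℂ).re) atTop atTop)
    (hχ : Tendsto (fun α => HalfPlane.pointEval (z α)) atTop (𝓝 χ)) :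
    ∃ Φ : StrongDual ℂ HalfPlane.LInfty, HalfPlane.IsTopologicallyInvariantMean Φ ∧
      ∀ φ : HalfPlane.HInfty, ∃ ψ : HalfPlane.LInfty,
        HalfPlane.IsBoundaryFunction φ ψ ∧ Φ ψ = χ φ := by
  obtain ⟨Φ, hΦ, hlim⟩ := HalfPlane.exists_isTopologicallyInvariantMean_of_tendsto_re_atTop hz
  refine ⟨Φ, hΦ, fun φ => ?_⟩
  obtain ⟨ψ, hψ⟩ := HalfPlane.exists_isBoundaryFunction φ
  have heval : Tendsto (fun α => HalfPlane.pointEval (z α) φ) atTop (𝓝 (χ φ)) :=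
    (((WeakDual.eval_continuous φ).comp continuous_subtype_val).tendsto χ).comp hχ
  exact ⟨ψ, hψ, hlim ψ (χ φ) (heval.congr fun α => (hψ.poissonFunctional_apply (z α)).symm)⟩
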